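/- A generalised Muller game is given by a finite directed graph $(V,E)$ in which every vertex has an outgoing edge, a starting vertex $v_0\in V$, a set $A$ of players, a partition $(V_a)_{a\in A}$ of $V$ (the blocks may be empty; player $a$ moves at the vertices of $V_a$), a set $O$ of outcomes, a map assigning an outcome to each set of vertices, and for each player $a\in A$ a binary relation $\prec_a$ on $O$. The outcome of an infinite path from $v_0$ is the one assigned to the set of vertices that the path visits infinitely often; below, $O$ is restricted to the outcomes of infinite paths from $v_0$ (the realizable outcomes). A strategy of player $a$ chooses an outgoing edge at each finite path from $v_0$ ending in $V_a$. A strategy profile (one strategy per player) induces an infinite path from $v_0$ and hence an outcome. It is a Nash equilibrium if no player $a$, by replacing her own strategy with any other strategy, obtains an outcome that is $\succ_a$ the one induced by the profile. A strategy $s$ of player $a$ is finite-memory if for some $m\in\mathbb N$ there is a function $f=(f_1,f_2): V\times\{0,1\}^m\to V\times\{0,1\}^m$ such that, with $M(v_0)=0^m$ and $M(hv)=f_2(v,M(h))$, one has $s(hv)=f_1(v,M(hv))$ for all finite paths $hv$ from $v_0$ with $v\in V_a$ (including $hv=v_0$ if $v_0\in V_a$). A profile is finite-memory if all its strategies are.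 A Nash equilibrium with outcome $o$ is Pareto-optimal if there is no realizable outcome $q\neq o$ such that $o\prec_a q$ for some player $a$ and $q\prec_b o$ for no player $b$. (1) If every $\prec_a$ is acyclic (for instance a strict weak order, or any strict partial order), then the game has a finite-memory Nash equilibrium. (2) If every $\prec_a$ is a strict linear order, and there are no players $a,b\in A$ and outcomes $x,y,z\in O$ with $z\prec_a y\prec_a x$ and $x\prec_b z\prec_b y$, then the game has a Pareto-optimal finite-memory Nash equilibrium. -/

import Mathlib

/-- A generalised Muller game: a directed graph in which every vertex has an outgoing edge, a
starting vertex, a partition of the vertices among the players (given by the `owner` map), a map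
giving an outcome to each possible set of vertices visited infinitely often, and for each player
a preference relation on outcomes (`pref a x y` is `x ≺_a y`). Taking `O = Set V` and
`outcome = id` gives preferences stated directly on sets of vertices. -/
structure MullerGame (V A O : Type*) where
  E : V → V → Prop
  exists_succ : ∀ v, ∃ w, E v w
  start : V
  owner : V → A
  outcome : Set V → O
  pref : A → O → O → Prop

namespace MullerGame

variable {V A O : Type*} (G : MullerGame V A O)

/-- Finite histories: the nonempty finite paths from the starting vertex, in chronological
order. -/
def History : Type _ :=
  {h : List V // h.head? = some G.start ∧ h.IsChain G.E}

theorem History.ne_nil {G : MullerGame V A O} (h : G.History) : h.1 ≠ [] := by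
  intro h0
  have := h.2.1
  simp [h0] at this

/-- The current vertex of a history. -/
def History.last {G : MullerGame V A O} (h : G.History) : V :=
  h.1.getLast h.ne_nil

/-- The history consisting of the starting vertex only. -/
def initial : G.History :=
  ⟨[G.start], by simp⟩

/-- Extension of a history along an edge. -/
def History.extend {G : MullerGame V A O} (h : G.History) (w : V) (hw : G.E h.last w) :
    G.History :=
  ⟨h.1 ++ [w], by
    refine ⟨?_, ?_⟩
    · rw [List.head?_append, h.2.1]; rfl
    · rw [List.isChain_append]
      refine ⟨h.2.2, by simp, ?_⟩
      intro x hx y hy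
      rw [List.getLast?_eq_some_getLast h.ne_nil] at hx
      simp only [Option.mem_def, Option.some.injEq, List.head?_cons] at hx hy
      subst hx hy
      exact hw⟩

theorem History.last_extend {G : MullerGame V A O} (h : G.History) (w : V)
    (hw : G.E h.last w) : (h.extend w hw).last = w := by
  simp [History.extend, History.last]

/-- The histories at which it is the turn of player `a`. -/
def HistoryOf (a : A) : Type _ :=
  {h : G.History // G.owner h.last = a}

/-- A strategy of player `a` picks an outgoing edge at each history ending in a vertex of `a`. -/
def Strategy (a : A) : Type _ :=
  {s : G.HistoryOf a → V // ∀ h : G.HistoryOf a, G.E h.1.last (s h)}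

/-- Strategy profiles. -/
def Profile : Type _ :=
  ∀ a : A, G.Strategy a

/-- The history reached after `n` moves under a strategy profile. -/
def historyAt (σ : G.Profile) : ℕ → G.History
  | 0 => G.initial
  | n + 1 =>
    let h := historyAt σ n
    h.extend ((σ (G.owner h.last)).1 ⟨h, rfl⟩) ((σ (G.owner h.last)).2 ⟨h, rfl⟩)

/-- The run induced by a strategy profile. -/
def inducedRun (σ : G.Profile) (n : ℕ) : V :=
  (G.historyAt σ n).last

/-- The infinite paths in the graph from the starting vertex. -/
def IsRun (p : ℕ → V) : Prop :=
  p 0 = G.start ∧ ∀ n, G.E (p n) (p (n + 1))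

theorem isRun_inducedRun (σ : G.Profile) : G.IsRun (G.inducedRun σ) := by
  refine ⟨rfl, fun n => ?_⟩
  have h : G.inducedRun σ (n + 1) =
      (σ (G.owner (G.historyAt σ n).last)).1 ⟨G.historyAt σ n, rfl⟩ :=
    History.last_extend _ _ ((σ (G.owner (G.historyAt σ n).last)).2 ⟨G.historyAt σ n, rfl⟩)
  rw [h]
  exact (σ (G.owner (G.historyAt σ n).last)).2 ⟨G.historyAt σ n, rfl⟩

/-- The set of vertices visited infinitely often. -/
def infSet (p : ℕ → V) : Set V :=
  {v | ∃ᶠ n in Filter.atTop, p n = v}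

/-- The outcomes that occur in the game: those assigned to some run. -/
def RealizableOutcome : Type _ :=
  {o : O // ∃ p, G.IsRun p ∧ G.outcome (infSet p) = o}

/-- The preference of a player on the outcomes that occur in the game. -/
def Prefers (a : A) (x y : G.RealizableOutcome) : Prop :=
  G.pref a x.1 y.1

/-- The outcome induced by a strategy profile. -/
def inducedOutcome (σ : G.Profile) : G.RealizableOutcome :=
  ⟨G.outcome (infSet (G.inducedRun σ)), G.inducedRun σ, G.isRun_inducedRun σ, rfl⟩

open Classical in
/-- Nash equilibrium: no player prefers the outcome obtained by changing only her own strategy,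
to any strategy whatsoever. -/
def IsNash (σ : G.Profile) : Prop :=
  ∀ (a : A) (s : G.Strategy a),
    ¬ G.Prefers a (G.inducedOutcome σ) (G.inducedOutcome (Function.update σ a s))

/-- Memory content, of `m` bits, after a history: it is `0^m` at the starting vertex, and is
updated upon reaching each further vertex. -/
def memory {m : ℕ} (f : V × (Fin m → Bool) → V × (Fin m → Bool)) (h : G.History) :
    Fin m → Bool :=
  h.1.tail.foldl (fun M v => (f (v, M)).2) (fun _ => false)

/-- A finite-memory strategy: one that is implemented by some
`f : V × {0,1}^m → V × {0,1}^m`, whose first component is the choice at the current vertex with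
the current memory content, and whose second component is the memory update. -/
def Strategy.IsFiniteMemory {G : MullerGame V A O} {a : A} (s : G.Strategy a) : Prop :=
  ∃ (m : ℕ) (f : V × (Fin m → Bool) → V × (Fin m → Bool)),
    ∀ h : G.HistoryOf a, s.1 h = (f (h.1.last, G.memory f h.1)).1

/-- A profile all of whose strategies are finite-memory. -/
def IsFiniteMemory (σ : G.Profile) : Prop :=
  ∀ a : A, (σ a).IsFiniteMemory

/-- Pareto-optimality: no other realizable outcome is preferred by some player while no player
has the opposite preference. -/
def IsParetoOptimal (o : G.RealizableOutcome) : Prop :=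
  ¬ ∃ q : G.RealizableOutcome, q ≠ o ∧ (∃ a, G.Prefers a o q) ∧ ∀ b, ¬ G.Prefers b q o

/-- The preferences have no cycles `x₁ ≺_a x₂ ≺_a ⋯ ≺_a x₁`. Strict partial orders, in particular
strict weak orders and strict linear orders, have this property. -/
def AcyclicPreferences : Prop :=
  ∀ (a : A) (x : G.RealizableOutcome), ¬ Relation.TransGen (G.Prefers a) x x

/-- The preferences are strict linear orders. -/
def LinearPreferences : Prop :=
  ∀ a : A, IsStrictTotalOrder G.RealizableOutcome (G.Prefers a)

/-- The pattern `z ≺_a y ≺_a x`, `x ≺_b z ≺_b y` does not occur. -/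
def AvoidsPattern : Prop :=
  ∀ (a b : A) (x y z : G.RealizableOutcome),
    ¬ ((G.Prefers a z y ∧ G.Prefers a y x) ∧ (G.Prefers b x z ∧ G.Prefers b z y))

end MullerGame

/-!
A two-player game, whose winner depends on the set of vertices visited infinitely often, is
determined with finite memory, by induction on the arena `U`. Consider the player who wins if all of
`U` is visited infinitely often. If her opponent wins from some vertex, then the induction
hypothesis applies to the rest of `U`. Otherwise it shows that she wins from every vertex if play is
stopped at a target of her choice, and she pursues all elements of `U` in turn: either all of them
are visited infinitely often, or she wins while pursuing one of them.

Hence, for a payoff in `ℕ`, a player can guarantee a value from each vertex, and the others can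
prevent her from getting more. If all players guarantee their values, each one passing on to a new
strategy whenever her value increases, then they produce a run on which every player obtains at
least her value at every vertex of the run. An ultimately periodic run with the same set of
vertices visited infinitely often has this property too, and is an equilibrium outcome if a
deviating player is punished with a strategy that keeps her down to her value at the vertex where
she deviates.

Acyclic preferences are respected by suitable payoffs. To obtain an outcome in a given set `K` of
outcomes that is upward closed for all preferences, let the payoffs be positive on `K` and zero
elsewhere, and start with any run whose outcome is in `K`: it either meets a vertex where the value
of some player is positive, where one passes to a run as above, or it can itself be used. For linear
preferences without the forbidden pattern, the Pareto-optimal outcomes are such a set: everyone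
prefers each of them to each of the other outcomes.
-/

namespace MullerGame

open Filter

/-! ### Vertices visited infinitely often -/

section InfSet

variable {V : Type*}

theorem infSet_add (p : ℕ → V) (k : ℕ) : infSet (fun n => p (n + k)) = infSet p := by
  ext v
  change (∃ᶠ n in atTop, p (n + k) = v) ↔ ∃ᶠ n in atTop, p n = v
  conv_rhs => rw [← map_add_atTop_eq_nat k, frequently_map]

theorem infSet_subset_range (p : ℕ → V) : infSet p ⊆ Set.range p :=
  fun _ hv => hv.exists

theorem infSet_eq_range_of_periodic {p : ℕ → V} {L : ℕ} (hp : Function.Periodic p L) (hL : 0 < L) :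
    infSet p = Set.range p := by
  refine (infSet_subset_range p).antisymm ?_
  rintro _ ⟨n, rfl⟩
  refine frequently_atTop.2 fun N => ⟨n + N * L, ?_, hp.nat_mul N n⟩
  exact (Nat.le_mul_of_pos_right N hL).trans (Nat.le_add_left _ _)

theorem eventually_mem_infSet [Finite V] (p : ℕ → V) : ∀ᶠ n in atTop, p n ∈ infSet p := by
  have hne : ∀ v, ∀ᶠ n in atTop, v ∉ infSet p → p n ≠ v := fun v =>
    eventually_imp_distrib_left.2 not_frequently.1
  filter_upwards [eventually_all.2 hne] with n hn
  by_contra h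
  exact hn _ h rfl

theorem exists_lasso [Finite V] (p : ℕ → V) :
    ∃ N M, N < M ∧ p M = p N ∧ p '' Set.Ico N M = infSet p := by
  obtain ⟨N, hN⟩ := eventually_atTop.1 (eventually_mem_infSet p)
  have hcover : ∀ v, ∀ᶠ M in atTop, v ∈ infSet p → v ∈ p '' Set.Ico N M := fun v =>
    eventually_imp_distrib_left.2 fun hv => by
      obtain ⟨k, hk, rfl⟩ := frequently_atTop.1 hv N
      filter_upwards [eventually_gt_atTop k] with M hM using ⟨k, ⟨hk, hM⟩, rfl⟩
  have hreturn : ∃ᶠ M in atTop, p M = p N := hN N le_rfl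
  obtain ⟨M, hM, hall, hlt⟩ :=
    (hreturn.and_eventually ((eventually_all.2 hcover).and (eventually_gt_atTop N))).exists
  refine ⟨N, M, hlt, hM, Set.Subset.antisymm ?_ fun v => hall v⟩
  rintro _ ⟨k, hk, rfl⟩
  exact hN k hk.1

/-- The position after `n` steps on the lasso that runs through `0, 1, …, M - 1` and then returns
to `N`. -/
def lassoIndex (N M n : ℕ) : ℕ :=
  if n < N then n else N + (n - N) % (M - N)

theorem lassoIndex_lt {N M : ℕ} (h : N < M) (n : ℕ) : lassoIndex N M n < M := by
  have := Nat.mod_lt (n - N) (Nat.sub_pos_of_lt h)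
  unfold lassoIndex
  split <;> omega

theorem lassoIndex_zero (N M : ℕ) : lassoIndex N M 0 = 0 := by
  unfold lassoIndex
  split <;> simp_all

theorem lassoIndex_succ {N M : ℕ} (h : N < M) (n : ℕ) :
    lassoIndex N M (n + 1) = if lassoIndex N M n + 1 < M then lassoIndex N M n + 1 else N := by
  rcases lt_trichotomy (n + 1) N with hn | hn | hn
  · grind [lassoIndex]
  · have := Nat.zero_mod (M - N)
    grind [lassoIndex]
  · have hr := Nat.mod_lt (n - N) (Nat.sub_pos_of_lt h)
    have hidx : lassoIndex N M n = N + (n - N) % (M - N) := if_neg (by omega)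
    have hidx' : lassoIndex N M (n + 1) = N + ((n - N) % (M - N) + 1) % (M - N) := by
      rw [Nat.mod_add_mod, ← Nat.sub_add_comm (by omega)]
      exact if_neg (by omega)
    rw [hidx, hidx']
    rcases (show (n - N) % (M - N) + 1 ≤ M - N from hr).eq_or_lt with h' | h'
    · rw [h', Nat.mod_self, if_neg (by omega), add_zero]
    · rw [Nat.mod_eq_of_lt h', if_pos (by omega), add_assoc]

theorem infSet_lassoIndex {N M : ℕ} (h : N < M) (p : ℕ → V) :
    infSet (fun n => p (lassoIndex N M n)) = p '' Set.Ico N M := by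
  have htail : ∀ n, lassoIndex N M (n + N) = N + n % (M - N) := fun n => by
    simp only [lassoIndex, if_neg (show ¬ n + N < N by omega), Nat.add_sub_cancel]
  have hperiodic : Function.Periodic (fun n => p (lassoIndex N M (n + N))) (M - N) := fun n => by
    simp only [htail, Nat.add_mod_right]
  rw [← infSet_add _ N, infSet_eq_range_of_periodic hperiodic (by omega)]
  ext v
  constructor
  · rintro ⟨n, rfl⟩
    have := Nat.mod_lt n (Nat.sub_pos_of_lt h)
    exact ⟨N + n % (M - N), ⟨by omega, by omega⟩, congrArg p (htail n).symm⟩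
  · rintro ⟨n, ⟨hNn, hnM⟩, rfl⟩
    refine ⟨n - N, congrArg p ?_⟩
    rw [htail, Nat.mod_eq_of_lt (by omega), Nat.add_sub_cancel' hNn]

theorem exists_finite_reindexing [Finite V] (p : ℕ → V) :
    ∃ (M : ℕ) (next : Fin M → Fin M) (idx : ℕ → Fin M), (idx 0).1 = 0 ∧
      (∀ n, idx (n + 1) = next (idx n)) ∧ (∀ i, p (next i) = p (i + 1)) ∧
      infSet (fun n => p (idx n)) = infSet p := by
  obtain ⟨N, M, hNM, hp, hinf⟩ := exists_lasso p
  let next : Fin M → Fin M := fun i => if h : i.1 + 1 < M then ⟨i.1 + 1, h⟩ else ⟨N, hNM⟩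
  have hnext : ∀ i, (next i).1 = if i.1 + 1 < M then i.1 + 1 else N := fun i => by
    simp only [next]
    split <;> rfl
  refine ⟨M, next, fun n => ⟨lassoIndex N M n, lassoIndex_lt hNM n⟩, lassoIndex_zero N M,
    fun n => Fin.ext ((lassoIndex_succ hNM n).trans (hnext ⟨_, _⟩).symm), fun i => ?_,
    (infSet_lassoIndex hNM p).trans hinf⟩
  rw [hnext]
  split_ifs with h
  · rfl
  · rw [show i.1 + 1 = M by omega, hp]

end InfSet

/-! ### Two-player games -/

section Arena

variable {V : Type*} {E : V → V → Prop} {P U Y Y' : Set V} {v : V}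

/-- A set of vertices on which the game can be played forever without leaving it. -/
def IsArena (E : V → V → Prop) (U : Set V) : Prop :=
  ∀ v ∈ U, ∃ w ∈ U, E v w

/-- The controllable predecessor of `Y`: the vertices from which the player owning `P` can force
the next vertex to be in `Y`, provided that her opponent stays inside `U`. -/
def cpre (E : V → V → Prop) (P U Y : Set V) : Set V :=
  {v | (v ∈ P → ∃ w ∈ Y, E v w) ∧ (v ∉ P → ∀ w ∈ U, E v w → w ∈ Y)}

theorem cpre_of_forall_edge (hv : v ∈ cpre E P U Y) (h : ∀ w ∈ Y, E v w → w ∈ Y') :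
    v ∈ cpre E P U Y' :=
  ⟨fun hP => let ⟨w, hw, hE⟩ := hv.1 hP; ⟨w, h w hw hE, hE⟩,
    fun hP w hw hE => h w (hv.2 hP w hw hE) hE⟩

theorem cpre_mono (h : Y ⊆ Y') : cpre E P U Y ⊆ cpre E P U Y' :=
  fun _ hv => cpre_of_forall_edge hv fun _ hw _ => h hw

theorem IsArena.subset_cpre (hU : IsArena E U) : U ⊆ cpre E P U U :=
  fun v hv => ⟨fun _ => hU v hv, fun _ _ hw _ => hw⟩

theorem IsArena.exists_edge_of_mem_cpre (hU : IsArena E U) (hv : v ∈ U) (h : v ∈ cpre E P U Y) :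
    ∃ w ∈ Y, E v w := by
  by_cases hP : v ∈ P
  · exact h.1 hP
  · obtain ⟨w, hw, hE⟩ := hU v hv
    exact ⟨w, h.2 hP w hw hE, hE⟩

theorem mem_cpre_compl_of_notMem_cpre (hv : v ∉ cpre E P U Y) :
    v ∈ cpre E Pᶜ U (U \ Y) := by
  by_cases hP : v ∈ P
  · have hY : ∀ w ∈ Y, ¬ E v w := fun w hw hE =>
      hv ⟨fun _ => ⟨w, hw, hE⟩, fun hP' => absurd hP hP'⟩
    exact ⟨fun hP' => absurd hP hP', fun _ w hw hE => ⟨hw, fun hwY => hY w hwY hE⟩⟩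
  · refine ⟨fun _ => ?_, fun hP' => absurd hP hP'⟩
    by_contra! h
    exact hv ⟨fun hP' => absurd hP' hP, fun _ w hw hE => by_contra fun hwY => h w ⟨hw, hwY⟩ hE⟩

end Arena

universe u w

section StrategyGraph

/-- A finite nondeterministic strategy in the arena `U` for the player owning `P`, whose opponent
may stop the play by moving into the set `D` of escapes, and who may stop it there herself: the
nodes are positions in `U` together with memory contents, and some move is compatible with each
continuation that the player cannot prevent. -/
structure StrategyGraph {V : Type u} (E : V → V → Prop) (P U D : Set V) where
  Node : Type w
  [finite : Finite Node]
  pos : Node → V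
  Move : Node → Node → Prop
  pos_mem : ∀ q, pos q ∈ U
  edge_of_move : ∀ {q q'}, Move q q' → E (pos q) (pos q')
  pos_mem_cpre : ∀ q, pos q ∈ cpre E P U (D ∪ pos '' {q' | Move q q'})

attribute [instance] StrategyGraph.finite

variable {V : Type u} {E : V → V → Prop} {P U D D' : Set V} {W : Set (Set V)}

/-- The paths through a strategy graph. -/
def StrategyGraph.IsPath (S : StrategyGraph.{u, w} E P U D) (x : ℕ → S.Node) : Prop :=
  ∀ n, S.Move (x n) (x (n + 1))

/-- A strategy graph is winning if in every infinite play that follows it, the set of vertices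
visited infinitely often is in `W`; plays stopped at an escape are disregarded. -/
def StrategyGraph.IsWinning (S : StrategyGraph.{u, w} E P U D) (W : Set (Set V)) : Prop :=
  ∀ x, S.IsPath x → infSet (fun n => S.pos (x n)) ∈ W

/-- The vertices from which some strategy graph is winning. -/
def winningRegion (E : V → V → Prop) (P : Set V) (W : Set (Set V)) (U D : Set V) : Set V :=
  {v | ∃ S : StrategyGraph.{u, u} E P U D, S.IsWinning W ∧ v ∈ Set.range S.pos}

theorem winningRegion_subset : winningRegion E P W U D ⊆ U := by
  rintro _ ⟨S, -, q, rfl⟩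
  exact S.pos_mem q

theorem winningRegion_mono {W' : Set (Set V)} (h : W ⊆ W') :
    winningRegion E P W U D ⊆ winningRegion E P W' U D :=
  fun _ ⟨S, hS, hv⟩ => ⟨S, fun x hx => h (hS x hx), hv⟩

theorem StrategyGraph.exists_move (S : StrategyGraph.{u, w} E P U ∅) {q : S.Node}
    (hq : S.pos q ∈ P) : ∃ q', S.Move q q' := by
  obtain ⟨w, hw | ⟨q', hq', -⟩, -⟩ := (S.pos_mem_cpre q).1 hq
  exacts [hw.elim, ⟨q', hq'⟩]

theorem StrategyGraph.exists_move_to (S : StrategyGraph.{u, w} E P U ∅) {q : S.Node}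
    (hq : S.pos q ∉ P) {w : V} (hw : w ∈ U) (hE : E (S.pos q) w) :
    ∃ q', S.Move q q' ∧ S.pos q' = w := by
  obtain h | h := (S.pos_mem_cpre q).2 hq w hw hE
  exacts [h.elim, h]

/-- The same strategy graph in a larger arena, where the opponent may leave `U'` only towards
additional escapes. -/
def StrategyGraph.enlarge {U' : Set V} (S : StrategyGraph.{u, w} E P U' D) (hU : U' ⊆ U)
    (hD : D ⊆ D') (hUD : ∀ v ∈ U', v ∉ P → ∀ w ∈ U, E v w → w ∈ U' ∪ D') :
    StrategyGraph.{u, w} E P U D' where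
  Node := S.Node
  pos := S.pos
  Move := S.Move
  pos_mem q := hU (S.pos_mem q)
  edge_of_move := S.edge_of_move
  pos_mem_cpre q := by
    have hcpre := cpre_mono (Set.union_subset_union_left _ hD) (S.pos_mem_cpre q)
    refine ⟨hcpre.1, fun hP w hw hE => ?_⟩
    obtain hw | hw := hUD _ (S.pos_mem q) hP w hw hE
    exacts [hcpre.2 hP w hw hE, .inl hw]

theorem winningRegion_subset_of_arena_subset {U' : Set V} (hU : U' ⊆ U) (hD : D ⊆ D')
    (hUD : ∀ v ∈ U', v ∉ P → ∀ w ∈ U, E v w → w ∈ U' ∪ D') :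
    winningRegion E P W U' D ⊆ winningRegion E P W U D' := by
  rintro v ⟨S, hS, hv⟩
  exact ⟨S.enlarge hU hD hUD, hS, hv⟩

end StrategyGraph

/-! ### Switching between strategy graphs -/

section Switch

variable {V : Type u} {E : V → V → Prop} {P U D' : Set V} {ι : Type w} {D : ι → Set V}

/-- Following one of the strategy graphs `S i`, with the possibility to switch from `S i` to `S j`
when moving to a vertex `v` such that `K i v j`. -/
inductive SwitchMove (S : ∀ i, StrategyGraph.{u, u} E P U (D i)) (K : ι → V → ι → Prop) :
    (Σ i, (S i).Node) → (Σ i, (S i).Node) → Prop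
  | stay {i q r} : (S i).Move q r → SwitchMove S K ⟨i, q⟩ ⟨i, r⟩
  | switch {i j q r} : K i ((S j).pos r) j → E ((S i).pos q) ((S j).pos r) →
      SwitchMove S K ⟨i, q⟩ ⟨j, r⟩

/-- The position of a node of one of several strategy graphs. -/
def switchPos (S : ∀ i, StrategyGraph.{u, u} E P U (D i)) (x : Σ i, (S i).Node) : V :=
  (S x.1).pos x.2

/-- The strategy graph of `SwitchMove`, when every escape of every `S i` allows a switch. -/
def switchGraph [Finite ι] (S : ∀ i, StrategyGraph.{u, u} E P U (D i)) (K : ι → V → ι → Prop)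
    (hK : ∀ i, ∀ w ∈ D i, w ∈ D' ∨ ∃ j q, (S j).pos q = w ∧ K i w j) :
    StrategyGraph.{u, max w u} E P U D' where
  Node := Σ i, (S i).Node
  pos := switchPos S
  Move := SwitchMove S K
  pos_mem x := (S x.1).pos_mem x.2
  edge_of_move := by
    rintro _ _ (h | ⟨-, h⟩)
    exacts [(S _).edge_of_move h, h]
  pos_mem_cpre := by
    rintro ⟨i, q⟩
    refine cpre_of_forall_edge ((S i).pos_mem_cpre q) ?_
    rintro w (hw | ⟨q', hq', rfl⟩) hE
    · obtain hw | ⟨j, q', rfl, hj⟩ := hK i w hw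
      exacts [.inl hw, .inr ⟨⟨j, q'⟩, .switch hj hE, rfl⟩]
    · exact .inr ⟨⟨i, q'⟩, .stay hq', rfl⟩

variable {S : ∀ i, StrategyGraph.{u, u} E P U (D i)} {K : ι → V → ι → Prop}

theorem SwitchMove.exists_stay {x y : Σ i, (S i).Node} (h : SwitchMove S K x y)
    (hK : ¬ K x.1 (switchPos S y) y.1) : ∃ q', y = ⟨x.1, q'⟩ ∧ (S x.1).Move x.2 q' := by
  obtain h | ⟨h, -⟩ := h
  exacts [⟨_, rfl, h⟩, absurd h hK]

theorem SwitchMove.fst_eq {x y : Σ i, (S i).Node} (h : SwitchMove S K x y)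
    (hK : ¬ K x.1 (switchPos S y) y.1) : y.1 = x.1 := by
  obtain ⟨_, rfl, -⟩ := h.exists_stay hK
  rfl

theorem SwitchMove.exists_isPath {x : ℕ → Σ i, (S i).Node}
    (hx : ∀ n, SwitchMove S K (x n) (x (n + 1)))
    (hK : ∀ n, ¬ K (x n).1 (switchPos S (x (n + 1))) (x (n + 1)).1) :
    ∃ i y, (S i).IsPath y ∧ ∀ n, x n = ⟨i, y n⟩ := by
  have hstay : ∀ n i q, x n = ⟨i, q⟩ → ∃ q', x (n + 1) = ⟨i, q'⟩ ∧ (S i).Move q q' := by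
    intro n i q hn
    have hmove := hx n
    have hKn := hK n
    rw [hn] at hmove hKn
    exact hmove.exists_stay hKn
  have hfst : ∀ n, ∃ q, x n = ⟨(x 0).1, q⟩ := fun n => by
    induction n with
    | zero => exact ⟨_, rfl⟩
    | succ n ih =>
      obtain ⟨q, hq⟩ := ih
      exact (hstay n _ q hq).imp fun _ => And.left
  choose y hy using hfst
  refine ⟨_, y, fun n => ?_, hy⟩
  obtain ⟨q', hq', hmove⟩ := hstay n _ _ (hy n)
  obtain rfl : y (n + 1) = q' := eq_of_heq (Sigma.mk.inj ((hy _).symm.trans hq')).2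
  exact hmove

theorem SwitchMove.infSet_mem {W : ι → Set (Set V)} (hS : ∀ i, (S i).IsWinning (W i))
    {x : ℕ → Σ i, (S i).Node} (hx : ∀ n, SwitchMove S K (x n) (x (n + 1)))
    (hK : ∀ᶠ n in atTop, ¬ K (x n).1 (switchPos S (x (n + 1))) (x (n + 1)).1) :
    ∃ i, (∀ᶠ n in atTop, (x n).1 = i) ∧ infSet (fun n => switchPos S (x n)) ∈ W i := by
  obtain ⟨N, hN⟩ := eventually_atTop.1 hK
  obtain ⟨i, y, hy, hxy⟩ := exists_isPath (x := fun n => x (n + N))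
    (fun n => by simpa only [Nat.add_right_comm n 1 N] using hx (n + N))
    (fun n => by
      simpa only [Nat.add_right_comm n 1 N] using hN (n + N) (Nat.le_add_left _ _))
  refine ⟨i, ?_, ?_⟩
  · filter_upwards [eventually_ge_atTop N] with n hn
    rw [← Nat.sub_add_cancel hn, hxy]
  · rw [← infSet_add _ N]
    simp only [hxy]
    exact hS i y hy

theorem eventually_not_lt_succ [Finite ι] {level : ι → ℕ} {i : ℕ → ι}
    (h : Monotone fun n => level (i n)) : ∀ᶠ n in atTop, ¬ level (i n) < level (i (n + 1)) := by
  obtain ⟨_, ⟨N, rfl⟩, hN⟩ :=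
    (Set.range i).exists_max_image level (Set.toFinite _) (Set.range_nonempty i)
  filter_upwards [eventually_ge_atTop N] with n hn
  exact not_lt.2 ((hN _ ⟨n + 1, rfl⟩).trans (h hn))

theorem SwitchMove.level_le {level : ι → ℕ} (hlevel : ∀ i v j, K i v j → level i < level j)
    {x y : Σ i, (S i).Node} (h : SwitchMove S K x y) : level x.1 ≤ level y.1 := by
  obtain _ | ⟨h, -⟩ := h
  exacts [le_rfl, (hlevel _ _ _ h).le]

theorem SwitchMove.infSet_mem_of_level [Finite ι] {W : ι → Set (Set V)}
    (hS : ∀ i, (S i).IsWinning (W i)) {level : ι → ℕ}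
    (hlevel : ∀ i v j, K i v j → level i < level j)
    {x : ℕ → Σ i, (S i).Node} (hx : ∀ n, SwitchMove S K (x n) (x (n + 1))) :
    ∃ i, (∀ᶠ n in atTop, (x n).1 = i) ∧ infSet (fun n => switchPos S (x n)) ∈ W i := by
  have hmono : Monotone fun n => level (x n).1 :=
    monotone_nat_of_le_succ fun n => (hx n).level_le hlevel
  refine SwitchMove.infSet_mem hS hx ?_
  filter_upwards [eventually_not_lt_succ hmono] with n hn hK
  exact hn (hlevel _ _ _ hK)

end Switch

/-! ### Determinacy -/

section Determinacy

variable {V : Type u} [Finite V] {E : V → V → Prop} {P U D D' : Set V} {W : Set (Set V)} {v : V}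

theorem exists_isWinning_range_eq_winningRegion (E : V → V → Prop) (P : Set V) (W : Set (Set V))
    (U D : Set V) :
    ∃ S : StrategyGraph.{u, u} E P U D, S.IsWinning W ∧
      Set.range S.pos = winningRegion E P W U D := by
  choose S hS hv using fun v : winningRegion E P W U D => v.2
  let T : StrategyGraph.{u, u} E P U D :=
    switchGraph S (fun _ _ _ => False) fun _ _ hw => .inl hw
  have hT : T.IsWinning W := fun x hx =>
    have ⟨_, _, h⟩ := SwitchMove.infSet_mem hS hx (.of_forall fun _ => id)
    h
  refine ⟨T, hT, Set.Subset.antisymm (fun v hv => ⟨T, hT, hv⟩) fun v hvW => ?_⟩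
  obtain ⟨q, hq⟩ := hv ⟨v, hvW⟩
  exact ⟨⟨⟨v, hvW⟩, q⟩, hq⟩

theorem winningRegion_subset_of_escape_subset (h : D' ⊆ D ∪ winningRegion E P W U D) :
    winningRegion E P W U D' ⊆ winningRegion E P W U D := by
  rintro _ ⟨S₀, hS₀, q₀, rfl⟩
  obtain ⟨S₁, hS₁, hrange⟩ := exists_isWinning_range_eq_winningRegion E P W U D
  let S : ∀ b : Bool, StrategyGraph.{u, u} E P U (bif b then D else D') := fun
    | false => S₀
    | true => S₁
  have hS : ∀ b, (S b).IsWinning W := fun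
    | false => hS₀
    | true => hS₁
  let T : StrategyGraph.{u, u} E P U D :=
    switchGraph S (fun b _ b' => b.toNat < b'.toNat) fun
      | true => fun w hw => .inl hw
      | false => fun w hw => (h hw).imp_right fun hw => by
          obtain ⟨q, hq⟩ := hrange.symm ▸ hw
          exact ⟨true, q, hq, Nat.one_pos⟩
  refine ⟨T, fun x hx => ?_, ⟨false, q₀⟩, rfl⟩
  obtain ⟨_, -, hW⟩ := SwitchMove.infSet_mem_of_level hS (fun _ _ _ => id) hx
  exact hW

theorem mem_winningRegion_of_mem_cpre (hvU : v ∈ U)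
    (hv : v ∈ cpre E P U (D ∪ winningRegion E P W U D)) : v ∈ winningRegion E P W U D := by
  let S : StrategyGraph.{u, u} E P U (D ∪ winningRegion E P W U D) :=
    { Node := PUnit
      pos := fun _ => v
      Move := fun _ _ => False
      pos_mem := fun _ => hvU
      edge_of_move := False.elim
      pos_mem_cpre := fun _ => cpre_mono Set.subset_union_left hv }
  exact winningRegion_subset_of_escape_subset subset_rfl ⟨S, fun _ hx => (hx 0).elim, ⟨⟩, rfl⟩

theorem IsArena.diff_winningRegion (hU : IsArena E U) :
    IsArena E (U \ (D ∪ winningRegion E P W U D)) := fun _ hv =>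
  hU.exists_edge_of_mem_cpre hv.1 <| mem_cpre_compl_of_notMem_cpre fun h =>
    hv.2 (.inr (mem_winningRegion_of_mem_cpre hv.1 h))

/-- Every vertex of `U` is winning for one of the two players in the arena `U`. -/
def IsDetermined (E : V → V → Prop) (P : Set V) (W : Set (Set V)) (U : Set V) : Prop :=
  U ⊆ winningRegion E P W U ∅ ∪ winningRegion E Pᶜ Wᶜ U ∅

omit [Finite V] in
theorem IsDetermined.compl (h : IsDetermined E Pᶜ Wᶜ U) : IsDetermined E P W U := by
  rw [IsDetermined, compl_compl, compl_compl, Set.union_comm] at h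
  exact h

theorem IsDetermined.diff_subset_winningRegion_compl
    (h : IsDetermined E P W (U \ (D ∪ winningRegion E P W U D))) :
    U \ (D ∪ winningRegion E P W U D) ⊆ winningRegion E Pᶜ Wᶜ U ∅ := by
  set X := D ∪ winningRegion E P W U D
  intro v hv
  obtain hvP | hvP := h hv
  · have hvX : v ∈ winningRegion E P W U X :=
      winningRegion_subset_of_arena_subset Set.sdiff_subset (Set.empty_subset _)
        (fun _ _ _ w hw _ => (em (w ∈ X)).symm.imp_left fun hwX => ⟨hw, hwX⟩) hvP
    exact absurd (.inr (winningRegion_subset_of_escape_subset subset_rfl hvX)) hv.2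
  · refine winningRegion_subset_of_arena_subset Set.sdiff_subset subset_rfl ?_ hvP
    intro v' hv' hv'P w hw hE
    refine .inl ⟨hw, fun hwX => hv'.2 (.inr (mem_winningRegion_of_mem_cpre hv'.1 ?_))⟩
    exact ⟨fun _ => ⟨w, hwX, hE⟩, fun h => absurd h hv'P⟩

theorem exists_transitive_map (α : Type*) [Finite α] :
    ∃ next : α → α, ∀ a b, ∃ k : ℕ, next^[k] a = b := by
  obtain ⟨f, hf, -⟩ := (Set.to_countable (Set.univ : Set α)).exists_cycleOn
  refine ⟨f, fun a b => ?_⟩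
  obtain ⟨k, hk⟩ := hf.exists_pow_eq' Set.finite_univ (Set.mem_univ a) (Set.mem_univ b)
  exact ⟨k, by rw [← hk, Equiv.Perm.iterate_eq_pow]⟩

theorem frequently_eq_of_transitive {ι : Type*} [Finite ι] {next : ι → ι}
    (hnext : ∀ i j, ∃ k : ℕ, next^[k] i = j) {i : ℕ → ι} {switch : ℕ → Prop}
    (hstay : ∀ n, ¬ switch n → i (n + 1) = i n)
    (hswitch : ∀ n, switch n → i (n + 1) = next (i n))
    (h : ∃ᶠ n in atTop, switch n) (j : ι) : ∃ᶠ n in atTop, switch n ∧ i n = j := by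
  have hwait : ∀ d n, switch (n + d) → ∃ m ≥ n, switch m ∧ i m = i n := fun d => by
    induction d with
    | zero => exact fun n hn => ⟨n, le_rfl, hn, rfl⟩
    | succ d ih =>
      intro n hn
      by_cases hs : switch n
      · exact ⟨n, le_rfl, hs, rfl⟩
      · obtain ⟨m, hm, hsm, him⟩ := ih (n + 1) (by rwa [Nat.add_right_comm])
        exact ⟨m, by omega, hsm, him.trans (hstay n hs)⟩
  have hstep : ∀ a, (∃ᶠ n in atTop, switch n ∧ i n = a) →
      ∃ᶠ n in atTop, switch n ∧ i n = next a := fun a ha => by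
    refine frequently_atTop.2 fun N => ?_
    obtain ⟨n, hn, hsn, rfl⟩ := frequently_atTop.1 ha N
    obtain ⟨m, hm, hsm⟩ := frequently_atTop.1 h (n + 1)
    obtain ⟨l, hl, hsl, hil⟩ := hwait (m - (n + 1)) (n + 1) (by rwa [Nat.add_sub_cancel' hm])
    exact ⟨l, by omega, hsl, hil.trans (hswitch n hsn)⟩
  obtain ⟨a, ha⟩ : ∃ a, ∃ᶠ n in atTop, switch n ∧ i n = a :=
    frequently_exists.1 (h.mono fun n hn => ⟨i n, hn, rfl⟩)
  obtain ⟨k, rfl⟩ := hnext a j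
  induction k with
  | zero => exact ha
  | succ k ih =>
    rw [Function.iterate_succ_apply']
    exact hstep _ ih

/-- The pursuit strategy: the player heads for the elements of `U` in cyclic order, changing the
target when it is reached. If all targets keep being reached, then all of `U` is visited
infinitely often. -/
theorem subset_winningRegion_of_mem (hW : U ∈ W)
    (h : ∀ v ∈ U, U ⊆ winningRegion E P W U {v}) : U ⊆ winningRegion E P W U ∅ := by
  intro v hv
  choose S hS hrange using fun v : U => exists_isWinning_range_eq_winningRegion E P W U {v.1}
  obtain ⟨next, hnext⟩ := exists_transitive_map U
  have hcover : ∀ v w : U, ∃ q, (S v).pos q = w := fun v w => by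
    rw [← Set.mem_range, hrange]
    exact h v v.2 w.2
  let K : U → V → U → Prop := fun v w v' => w = v ∧ v' = next v
  let T : StrategyGraph.{u, u} E P U ∅ := switchGraph S K fun v w hw => by
    obtain ⟨q, hq⟩ := hcover (next v) v
    exact .inr ⟨next v, q, hq.trans (Set.mem_singleton_iff.1 hw).symm, hw, rfl⟩
  obtain ⟨q, hq⟩ := hcover ⟨v, hv⟩ ⟨v, hv⟩
  refine ⟨T, fun x hx => ?_, ⟨⟨v, hv⟩, q⟩, hq⟩
  by_cases hK : ∃ᶠ n in atTop, K (x n).1 (switchPos S (x (n + 1))) (x (n + 1)).1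
  · have hinf : U ⊆ infSet fun n => T.pos (x n) := fun w hw => by
      have hvisit := frequently_eq_of_transitive (i := fun n => (x n).1) hnext
        (fun n hn => SwitchMove.fst_eq (hx n) hn) (fun n hn => hn.2) hK ⟨w, hw⟩
      rw [← infSet_add _ 1]
      exact hvisit.mono fun n hn => hn.1.1.trans (congrArg Subtype.val hn.2)
    have hU : infSet (fun n => T.pos (x n)) ⊆ U :=
      (infSet_subset_range _).trans (Set.range_subset_iff.2 fun n => T.pos_mem (x n))
    rwa [hU.antisymm hinf]
  · obtain ⟨_, -, hmem⟩ := SwitchMove.infSet_mem hS hx (not_frequently.1 hK)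
    exact hmem

theorem IsArena.isDetermined_of_mem (hU : IsArena E U) (hW : U ∈ W)
    (ih : ∀ U' ⊂ U, IsArena E U' → ∀ P W, IsDetermined E P W U') : IsDetermined E P W U := by
  have hdiff : ∀ P W D, (U ∩ (D ∪ winningRegion E P W U D)).Nonempty →
      U \ (D ∪ winningRegion E P W U D) ⊆ winningRegion E Pᶜ Wᶜ U ∅ := fun P W D hne =>
    have hlt := Set.sdiff_ssubset_left_iff.2 hne
    (ih _ hlt hU.diff_winningRegion P W).diff_subset_winningRegion_compl
  rcases (winningRegion E Pᶜ Wᶜ U ∅).eq_empty_or_nonempty with hB | ⟨b, hb⟩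
  · have hsingleton : ∀ v ∈ U, U ⊆ {v} ∪ winningRegion E P W U {v} := fun v hv =>
      Set.sdiff_eq_empty.1 (Set.subset_empty_iff.1 (hB ▸ hdiff P W {v} ⟨v, hv, .inl rfl⟩))
    refine Set.subset_union_of_subset_left (subset_winningRegion_of_mem hW fun v hv => ?_) _
    have hmem : v ∈ winningRegion E P W U {v} :=
      mem_winningRegion_of_mem_cpre hv (cpre_mono (hsingleton v hv) (hU.subset_cpre hv))
    exact fun w hw => (hsingleton v hv hw).elim (fun h => h ▸ hmem) id
  · have hA := hdiff Pᶜ Wᶜ ∅ ⟨b, winningRegion_subset hb, .inr hb⟩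
    rw [compl_compl, compl_compl, Set.empty_union] at hA
    exact fun v hv => (em (v ∈ winningRegion E Pᶜ Wᶜ U ∅)).symm.imp_left fun hvB => hA ⟨hv, hvB⟩

theorem IsArena.isDetermined (hU : IsArena E U) (P : Set V) (W : Set (Set V)) :
    IsDetermined E P W U := by
  induction U using WellFoundedLT.induction generalizing P W with
  | ind U ih =>
    by_cases hW : U ∈ W
    · exact hU.isDetermined_of_mem hW ih
    · exact (hU.isDetermined_of_mem (P := Pᶜ) (W := Wᶜ) hW ih).compl

end Determinacy

/-! ### Values -/

section Value

variable {V : Type u} {E : V → V → Prop} {P U D D' : Set V} {W : Set (Set V)} {v : V}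

/-- The part of a strategy graph over `B`, where play is stopped on leaving `B`. -/
def StrategyGraph.restrict (S : StrategyGraph.{u, w} E P U D) (B : Set V) (hD : D ∪ Bᶜ ⊆ D') :
    StrategyGraph.{u, w} E P U D' where
  Node := {q // S.pos q ∈ B}
  pos q := S.pos q.1
  Move q q' := S.Move q.1 q'.1
  pos_mem q := S.pos_mem q.1
  edge_of_move := S.edge_of_move
  pos_mem_cpre q := by
    refine cpre_mono ?_ (S.pos_mem_cpre q.1)
    rintro w (hw | ⟨q', hq', rfl⟩)
    · exact .inl (hD (.inl hw))
    · by_cases hB : S.pos q' ∈ B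
      · exact .inr ⟨⟨q', hB⟩, hq', rfl⟩
      · exact .inl (hD (.inr hB))

theorem mem_winningRegion_of_forall_mem [Finite V] (hE : IsArena E Set.univ) (hW : ∀ B, B ∈ W) :
    v ∈ winningRegion E P W Set.univ D := by
  let S : StrategyGraph.{u, u} E P Set.univ D :=
    { Node := V
      pos := id
      Move := E
      pos_mem := Set.mem_univ
      edge_of_move := id
      pos_mem_cpre := fun v =>
        cpre_of_forall_edge (hE.subset_cpre (Set.mem_univ v)) fun w _ h => .inr ⟨w, h, rfl⟩ }
  exact ⟨S, fun _ _ => hW _, v, rfl⟩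

open Classical in
/-- The largest payoff, among those given by `r` to the sets of vertices visited infinitely often,
that the player owning `P` can guarantee from a vertex. -/
noncomputable def value (E : V → V → Prop) (P : Set V) (r : Set V → ℕ) (v : V) : ℕ :=
  Nat.findGreatest (fun k => v ∈ winningRegion E P {B | k ≤ r B} Set.univ ∅) (⨆ B, r B)

variable [Finite V]

theorem mem_winningRegion_value (hE : IsArena E Set.univ) (P : Set V) (r : Set V → ℕ) (v : V) :
    v ∈ winningRegion E P {B | value E P r v ≤ r B} Set.univ ∅ := by
  classical
  exact Nat.findGreatest_spec (P := fun k => v ∈ winningRegion E P {B | k ≤ r B} Set.univ ∅)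
    (Nat.zero_le _) (mem_winningRegion_of_forall_mem hE fun B => Nat.zero_le (r B))

theorem mem_winningRegion_compl_value (hE : IsArena E Set.univ) (P : Set V) (r : Set V → ℕ)
    (v : V) : v ∈ winningRegion E Pᶜ {B | r B ≤ value E P r v} Set.univ ∅ := by
  classical
  by_cases hv : value E P r v < ⨆ B, r B
  · have hnot : v ∉ winningRegion E P {B | value E P r v + 1 ≤ r B} Set.univ ∅ :=
      Nat.findGreatest_is_greatest (Nat.lt_succ_self _) hv
    have hmem := (hE.isDetermined P _ (Set.mem_univ v)).resolve_left hnot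
    simpa only [Set.compl_ofPred, Nat.succ_le_iff, not_lt] using hmem
  · exact mem_winningRegion_of_forall_mem hE fun B =>
      (le_ciSup (Set.finite_range r).bddAbove B).trans (not_lt.1 hv)

theorem exists_strategyGraph_value_le (hE : IsArena E Set.univ) (P : Set V) (r : Set V → ℕ) :
    ∃ S : StrategyGraph.{u, u} E P Set.univ ∅, Function.Surjective S.pos ∧
      ∀ x, S.IsPath x → ∀ n, value E P r (S.pos (x n)) ≤ r (infSet fun n => S.pos (x n)) := by
  choose S₀ hS₀ q hq using mem_winningRegion_value hE P r
  let D : V → Set V := fun v => {w | value E P r w ≤ value E P r v}ᶜ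
  let S : ∀ v, StrategyGraph.{u, u} E P Set.univ (D v) := fun v =>
    (S₀ v).restrict {w | value E P r w ≤ value E P r v} (Set.empty_union _).subset
  have hS : ∀ v, (S v).IsWinning {B | value E P r v ≤ r B} := fun v x hx =>
    hS₀ v (fun n => (x n).1) hx
  let node : ∀ v, (S v).Node := fun v => ⟨q v, (congrArg (value E P r) (hq v)).le⟩
  let T : StrategyGraph.{u, u} E P Set.univ ∅ :=
    switchGraph S (fun v _ v' => value E P r v < value E P r v') fun _ w hw =>
      .inr ⟨w, node w, hq w, lt_of_not_ge hw⟩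
  refine ⟨T, fun v => ⟨⟨v, node v⟩, hq v⟩, fun x hx n => ?_⟩
  obtain ⟨v, hv, hr⟩ := SwitchMove.infSet_mem_of_level hS (fun _ _ _ => id) hx
  have hmono : Monotone fun n => value E P r (x n).1 :=
    monotone_nat_of_le_succ fun n => (hx n).level_le fun _ _ _ => id
  obtain ⟨m, hm, hnm⟩ := (hv.and (eventually_ge_atTop n)).exists
  calc value E P r (T.pos (x n)) ≤ value E P r (x n).1 := (x n).2.2
    _ ≤ value E P r (x m).1 := hmono hnm
    _ = value E P r v := by rw [hm]
    _ ≤ _ := hr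

end Value

section ValuePath

variable {V : Type u} {A : Type*} {E : V → V → Prop} {owner : V → A} {v : V}

theorem exists_common_path (S : ∀ a, StrategyGraph.{u, u} E {v | owner v = a} Set.univ ∅)
    (q : ∀ a, (S a).Node) (hq : ∀ a, (S a).pos (q a) = v) :
    ∃ p : ℕ → V, p 0 = v ∧ (∀ n, E (p n) (p (n + 1))) ∧
      ∀ a, ∃ x, (S a).IsPath x ∧ ∀ n, (S a).pos (x n) = p n := by
  have hstep : ∀ s : {s : V × ∀ a, (S a).Node // ∀ a, (S a).pos (s.2 a) = s.1},
      ∃ s' : {s : V × ∀ a, (S a).Node // ∀ a, (S a).pos (s.2 a) = s.1},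
        E s.1.1 s'.1.1 ∧ ∀ a, (S a).Move (s.1.2 a) (s'.1.2 a) := by
    rintro ⟨⟨v, q⟩, hq⟩
    obtain ⟨q', hq'⟩ := (S (owner v)).exists_move
      (q := q (owner v)) (congrArg owner (hq (owner v)))
    have hE : E v ((S (owner v)).pos q') := by
      simpa only [hq] using (S (owner v)).edge_of_move hq'
    have hmove : ∀ a, ∃ q'', (S a).Move (q a) q'' ∧ (S a).pos q'' = (S (owner v)).pos q' := by
      intro a
      by_cases ha : owner v = a
      · subst ha
        exact ⟨q', hq', rfl⟩
      · exact (S a).exists_move_to (by rwa [hq]) (Set.mem_univ _) (by rwa [hq])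
    choose q'' hmove hpos using hmove
    exact ⟨⟨⟨_, q''⟩, hpos⟩, hE, hmove⟩
  choose step hE hmove using hstep
  let s : ℕ → _ := fun n => step^[n] ⟨⟨v, q⟩, hq⟩
  have hs : ∀ n, s (n + 1) = step (s n) := fun n => Function.iterate_succ_apply' step n _
  exact ⟨fun n => (s n).1.1, rfl, fun n => by simpa only [hs] using hE (s n), fun a =>
    ⟨fun n => (s n).1.2 a, fun n => by simpa only [hs] using hmove (s n) a, fun n => (s n).2 a⟩⟩

theorem exists_path_value_le [Finite V] (hE : IsArena E Set.univ) (owner : V → A)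
    (r : A → Set V → ℕ) (v : V) :
    ∃ p : ℕ → V, p 0 = v ∧ (∀ n, E (p n) (p (n + 1))) ∧
      ∀ a n, value E {v | owner v = a} (r a) (p n) ≤ r a (infSet p) := by
  choose S hS hvalue using fun a => exists_strategyGraph_value_le hE {v | owner v = a} (r a)
  choose q hq using fun a => hS a v
  obtain ⟨p, hp0, hpE, hp⟩ := exists_common_path S q hq
  refine ⟨p, hp0, hpE, fun a n => ?_⟩
  obtain ⟨x, hx, hxp⟩ := hp a
  simpa only [hxp] using hvalue a x hx n

theorem exists_path_append {p₀ p : ℕ → V} (hp₀ : ∀ n, E (p₀ n) (p₀ (n + 1)))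
    (hp : ∀ n, E (p n) (p (n + 1))) {N : ℕ} (h : p 0 = p₀ N) :
    ∃ p' : ℕ → V, (∀ n ≤ N, p' n = p₀ n) ∧ (∀ n, p' (n + N) = p n) ∧
      ∀ n, E (p' n) (p' (n + 1)) := by
  let p' : ℕ → V := fun n => if n < N then p₀ n else p (n - N)
  have hle : ∀ n ≤ N, p' n = p₀ n := fun n hn => by
    rcases hn.lt_or_eq with hn | rfl
    · exact if_pos hn
    · exact (if_neg (lt_irrefl _)).trans (by rw [Nat.sub_self, h])
  have hge : ∀ n, p' (n + N) = p n := fun n =>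
    (if_neg (by omega)).trans (by rw [Nat.add_sub_cancel])
  refine ⟨p', hle, hge, fun n => ?_⟩
  obtain hn | hn := lt_or_ge n N
  · rw [hle n hn.le, hle (n + 1) hn]
    exact hp₀ n
  · obtain ⟨k, rfl⟩ := Nat.exists_eq_add_of_le' hn
    rw [Nat.add_right_comm, hge, hge]
    exact hp k

theorem exists_path_value_le_of_path [Finite V] (hE : IsArena E Set.univ) (owner : V → A)
    (r : A → Set V → ℕ) {p₀ : ℕ → V} (hp₀ : ∀ n, E (p₀ n) (p₀ (n + 1))) :
    ∃ p : ℕ → V, p 0 = p₀ 0 ∧ (∀ n, E (p n) (p (n + 1))) ∧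
      (∀ a n, value E {v | owner v = a} (r a) (p n) ≤ r a (infSet p)) ∧
      (infSet p = infSet p₀ ∨ ∃ a, 0 < r a (infSet p)) := by
  classical
  by_cases h : ∃ n a, 0 < value E {v | owner v = a} (r a) (p₀ n)
  · obtain ⟨a, ha⟩ := Nat.find_spec h
    obtain ⟨p, hp0, hpE, hp⟩ := exists_path_value_le hE owner r (p₀ (Nat.find h))
    obtain ⟨p', hle, hge, hE'⟩ := exists_path_append hp₀ hpE hp0
    have hinf : infSet p' = infSet p := by simpa only [hge] using (infSet_add p' (Nat.find h)).symm
    refine ⟨p', hle 0 (Nat.zero_le _), hE', fun b n => ?_, .inr ⟨a, ?_⟩⟩ <;> rw [hinf]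
    · obtain hn | hn := lt_or_ge n (Nat.find h)
      · rw [hle n hn.le]
        exact (not_lt.1 fun hb => Nat.find_min h hn ⟨b, hb⟩).trans (Nat.zero_le _)
      · obtain ⟨k, rfl⟩ := Nat.exists_eq_add_of_le' hn
        rw [hge]
        exact hp b k
    · exact ha.trans_le (hp0 ▸ hp a 0)
  · push Not at h
    exact ⟨p₀, rfl, hp₀, fun a n => (h n a).trans (Nat.zero_le _), .inl rfl⟩

end ValuePath

/-! ### Finite-memory profiles -/

section Machine

variable {V : Type u} {A O : Type*} {G : MullerGame V A O}

theorem inducedRun_succ (τ : G.Profile) (n : ℕ) :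
    G.inducedRun τ (n + 1) = (τ (G.owner (G.inducedRun τ n))).1 ⟨G.historyAt τ n, rfl⟩ :=
  History.last_extend _ _ ((τ _).2 ⟨G.historyAt τ n, rfl⟩)

theorem exists_bit_encoding (S : Type*) [Finite S] (s₀ : S) :
    ∃ (m : ℕ) (e : S → Fin m → Bool), Function.Injective e ∧ e s₀ = fun _ => false := by
  classical
  obtain ⟨m, ⟨f⟩⟩ := Finite.exists_equiv_fin S
  refine ⟨m, fun s i => xor (decide (f s = i)) (decide (f s₀ = i)), fun s s' h => ?_, ?_⟩
  · have hs := congrFun h (f s)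
    simp only [decide_true, Bool.xor_left_inj, true_eq_decide_iff] at hs
    exact (f.injective hs).symm
  · exact funext fun i => Bool.xor_self _

/-- A finite automaton that reads the vertices of a play one after the other, remembers at least
the current vertex, and proposes a successor of it. -/
structure Machine (G : MullerGame V A O) where
  State : Type w
  [finite : Finite State]
  init : State
  pos : State → V
  step : State → V → State
  act : State → V
  pos_init : pos init = G.start
  pos_step : ∀ s v, pos (step s v) = v
  edge_act : ∀ s, G.E (pos s) (act s)

namespace Machine

attribute [instance] Machine.finite

variable (M : Machine.{u, w} G)

/-- The state of a machine after reading a history. -/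
def stateAfter (h : G.History) : M.State :=
  h.1.tail.foldl M.step M.init

theorem pos_foldl_step (l : List V) (s : M.State) :
    M.pos (l.foldl M.step s) = (M.pos s :: l).getLast (List.cons_ne_nil _ _) := by
  induction l generalizing s with
  | nil => rfl
  | cons v l ih => rw [List.foldl_cons, ih, List.getLast_cons_cons, M.pos_step]

theorem pos_stateAfter (h : G.History) : M.pos (M.stateAfter h) = h.last := by
  obtain ⟨l, hl⟩ := List.head?_eq_some_iff.1 h.2.1
  simp only [stateAfter, History.last, hl, List.tail_cons, pos_foldl_step, M.pos_init]

theorem stateAfter_historyAt_succ (τ : G.Profile) (n : ℕ) :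
    M.stateAfter (G.historyAt τ (n + 1)) =
      M.step (M.stateAfter (G.historyAt τ n)) (G.inducedRun τ (n + 1)) := by
  rw [inducedRun_succ, stateAfter, stateAfter]
  change (List.tail ((G.historyAt τ n).1 ++ [_])).foldl _ _ = _
  rw [List.tail_append_of_ne_nil (History.ne_nil _), List.foldl_append]
  rfl

/-- The profile in which all players do as the machine proposes. -/
def profile : G.Profile := fun _ =>
  ⟨fun h => M.act (M.stateAfter h.1), fun h => M.pos_stateAfter h.1 ▸ M.edge_act _⟩

theorem isFiniteMemory_profile : G.IsFiniteMemory M.profile := by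
  intro a
  obtain ⟨m, e, he, he₀⟩ := exists_bit_encoding M.State M.init
  have : Nonempty M.State := ⟨M.init⟩
  have hd := Function.leftInverse_invFun he
  let f : V × (Fin m → Bool) → V × (Fin m → Bool) := fun x =>
    (M.act (Function.invFun e x.2), e (M.step (Function.invFun e x.2) x.1))
  have hfold : ∀ (l : List V) (s : M.State),
      l.foldl (fun c v => (f (v, c)).2) (e s) = e (l.foldl M.step s) := by
    intro l
    induction l with
    | nil => exact fun _ => rfl
    | cons v l ih =>
      intro s
      rw [List.foldl_cons, List.foldl_cons, ← ih]
      simp only [f, hd s]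
  refine ⟨m, f, fun h => ?_⟩
  rw [memory, ← he₀, hfold]
  simp only [f, hd _, profile, stateAfter]

/-- The sequences of states in which the proposals of the machine are followed at all vertices
outside `C`. -/
def IsPlay (C : Set V) (s : ℕ → M.State) : Prop :=
  s 0 = M.init ∧ ∀ n, ∃ v, G.E (M.pos (s n)) v ∧ (M.pos (s n) ∉ C → v = M.act (s n)) ∧
    s (n + 1) = M.step (s n) v

theorem isPlay_stateAfter {τ : G.Profile} {C : Set V}
    (hτ : ∀ v ∉ C, τ (G.owner v) = M.profile (G.owner v)) :
    M.IsPlay C fun n => M.stateAfter (G.historyAt τ n) := by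
  refine ⟨rfl, fun n => ⟨G.inducedRun τ (n + 1), ?_, fun hC => ?_,
    M.stateAfter_historyAt_succ τ n⟩⟩
  · rw [pos_stateAfter]
    exact (G.isRun_inducedRun τ).2 n
  · rw [pos_stateAfter] at hC
    rw [inducedRun_succ, show τ (G.owner (G.inducedRun τ n)) = _ from hτ _ hC]
    rfl

theorem infSet_pos_stateAfter (τ : G.Profile) :
    infSet (fun n => M.pos (M.stateAfter (G.historyAt τ n))) = infSet (G.inducedRun τ) := by
  simp only [pos_stateAfter]
  rfl

end Machine

end Machine

/-! ### Punishing deviations -/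

section Punishment

variable {V : Type u} {A O : Type*} {G : MullerGame V A O}

/-- An ultimately periodic run, together with a strategy graph at each of its positions, which the
other players are to follow after the owner of that position has left the run there. -/
structure PunishmentPlan (G : MullerGame V A O) where
  Index : Type
  [finite : Finite Index]
  init : Index
  next : Index → Index
  path : Index → V
  path_init : path init = G.start
  edge_path : ∀ i, G.E (path i) (path (next i))
  graph : ∀ i, StrategyGraph.{u, u} G.E {v | G.owner v = G.owner (path i)}ᶜ Set.univ ∅
  root : ∀ i, (graph i).Node
  pos_root : ∀ i, (graph i).pos (root i) = path i

namespace PunishmentPlan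

attribute [instance] PunishmentPlan.finite

variable (T : PunishmentPlan G)

/-- The states of the machine that implements a punishment plan: the play is still at the position
`i` of the run, or the players have been following the `i`-th strategy graph and are at its node
`q`, or neither is the case and the current vertex is `v`. -/
inductive State : Type u
  | lead (i : T.Index)
  | punish (i : T.Index) (q : (T.graph i).Node)
  | lost (v : V)

instance [Finite V] : Finite T.State := by
  let f : T.Index ⊕ (Σ i, (T.graph i).Node) ⊕ V → T.State :=
    Sum.elim .lead (Sum.elim (fun x => .punish x.1 x.2) .lost)
  refine Finite.of_surjective f fun
    | .lead i => ⟨.inl i, rfl⟩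
    | .punish i q => ⟨.inr (.inl ⟨i, q⟩), rfl⟩
    | .lost v => ⟨.inr (.inr v), rfl⟩

/-- The current vertex in a state. -/
def State.pos : T.State → V
  | .lead i => T.path i
  | .punish i q => (T.graph i).pos q
  | .lost v => v

open Classical in
/-- The state after moving to `v` from the node `q` of the `i`-th strategy graph. -/
noncomputable def punishStep (i : T.Index) (q : (T.graph i).Node) (v : V) : T.State :=
  if h : ∃ q', (T.graph i).Move q q' ∧ (T.graph i).pos q' = v then .punish i h.choose else .lost v

open Classical in
/-- The state after moving to `v`. -/
noncomputable def step : T.State → V → T.State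
  | .lead i, v => if v = T.path (T.next i) then .lead (T.next i) else T.punishStep i (T.root i) v
  | .punish i q, v => T.punishStep i q v
  | .lost _, v => .lost v

open Classical in
/-- The proposed successor of the current vertex. -/
noncomputable def act : T.State → V
  | .lead i => T.path (T.next i)
  | .punish i q =>
    if h : ∃ q', (T.graph i).Move q q' then (T.graph i).pos h.choose
    else (G.exists_succ ((T.graph i).pos q)).choose
  | .lost v => (G.exists_succ v).choose

theorem pos_punishStep (i : T.Index) (q : (T.graph i).Node) (v : V) :
    (T.punishStep i q v).pos = v := by
  unfold punishStep
  split_ifs with h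
  exacts [h.choose_spec.2, rfl]

theorem pos_step (s : T.State) (v : V) : (T.step s v).pos = v := by
  cases s with
  | lead i =>
    simp only [step]
    split_ifs with h
    exacts [h.symm, T.pos_punishStep i _ v]
  | punish i q => exact T.pos_punishStep i q v
  | lost _ => rfl

theorem edge_act (s : T.State) : G.E s.pos (T.act s) := by
  cases s with
  | lead i => exact T.edge_path i
  | punish i q =>
    simp only [act]
    split_ifs with h
    exacts [(T.graph i).edge_of_move h.choose_spec, (G.exists_succ _).choose_spec]
  | lost v => exact (G.exists_succ v).choose_spec

/-- The machine that proposes to follow the run of the plan, and after a deviation the strategy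
graph of the position at which it has occurred. -/
noncomputable def machine [Finite V] : Machine.{u, u} G where
  State := T.State
  init := .lead T.init
  pos := State.pos T
  step := T.step
  act := T.act
  pos_init := T.path_init
  pos_step := T.pos_step
  edge_act := T.edge_act

variable {T}

theorem exists_punishStep_eq {i : T.Index} {q : (T.graph i).Node} {v : V}
    (hE : G.E ((T.graph i).pos q) v)
    (hv : G.owner ((T.graph i).pos q) ≠ G.owner (T.path i) → v = T.act (.punish i q)) :
    ∃ q', (T.graph i).Move q q' ∧ T.punishStep i q v = .punish i q' := by
  have h : ∃ q', (T.graph i).Move q q' ∧ (T.graph i).pos q' = v := by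
    by_cases hq : G.owner ((T.graph i).pos q) = G.owner (T.path i)
    · exact (T.graph i).exists_move_to (not_not.2 hq) trivial hE
    · have hmove := (T.graph i).exists_move hq
      rw [hv hq, act, dif_pos hmove]
      exact ⟨_, hmove.choose_spec, rfl⟩
  exact ⟨h.choose, h.choose_spec.1, dif_pos h⟩

section Play

variable [Finite V] {C : Set V} {s : ℕ → T.State} {m : ℕ} {i : T.Index}

theorem lead_or_punish_succ (hs : T.machine.IsPlay C s) (hm : s m = .lead i) :
    s (m + 1) = .lead (T.next i) ∨ T.path i ∈ C ∧ ∃ q, s (m + 1) = .punish i q := by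
  obtain ⟨v, hE, hv, hstep⟩ := hs.2 m
  simp only [machine, hm, step] at hE hv hstep
  split_ifs at hstep with hnext
  · exact .inl hstep
  · obtain ⟨q, -, hq⟩ := exists_punishStep_eq (q := T.root i) (v := v)
      (by rw [T.pos_root]; exact hE) fun h => (h (congrArg G.owner (T.pos_root i))).elim
    exact .inr ⟨of_not_not fun hC => hnext (hv hC), q, hstep.trans hq⟩

theorem lead_or_exists_punish (hs : T.machine.IsPlay C s) :
    (∀ n, s n = .lead (T.next^[n] T.init)) ∨
      ∃ i, T.path i ∈ C ∧ ∃ m q, s m = .punish i q := by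
  refine or_iff_not_imp_right.2 fun hpunish n => ?_
  induction n with
  | zero => exact hs.1
  | succ n ih =>
    rw [Function.iterate_succ_apply']
    refine (lead_or_punish_succ hs ih).resolve_right ?_
    rintro ⟨hC, q, hq⟩
    exact hpunish ⟨_, hC, _, q, hq⟩

theorem exists_isPath_of_punish (hs : T.machine.IsPlay C s)
    (hC : ∀ v ∈ C, G.owner v = G.owner (T.path i)) {q : (T.graph i).Node}
    (hm : s m = .punish i q) :
    ∃ x, (T.graph i).IsPath x ∧ ∀ n, s (n + m) = .punish i (x n) := by
  have hmove : ∀ n q, s (n + m) = .punish i q →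
      ∃ q', (T.graph i).Move q q' ∧ s (n + 1 + m) = .punish i q' := by
    intro n q hq
    obtain ⟨v, hE, hv, hstep⟩ := hs.2 (n + m)
    simp only [machine, hq] at hE hv hstep
    obtain ⟨q', hmove, hq'⟩ := exists_punishStep_eq hE fun h => hv fun hC' => h (hC _ hC')
    exact ⟨q', hmove, by rw [Nat.add_right_comm, hstep]; exact hq'⟩
  have hpunish : ∀ n, ∃ q, s (n + m) = .punish i q := by
    intro n
    induction n with
    | zero => exact ⟨q, by rwa [Nat.zero_add]⟩
    | succ n ih => exact let ⟨q, hq⟩ := ih; let ⟨q', _, hq'⟩ := hmove n q hq; ⟨q', hq'⟩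
  choose x hx using hpunish
  refine ⟨x, fun n => ?_, hx⟩
  obtain ⟨q', h, hq'⟩ := hmove n (x n) (hx n)
  cases (hx (n + 1)).symm.trans hq'
  exact h

theorem infSet_of_isPlay (hs : T.machine.IsPlay C s)
    (hC : ∀ u ∈ C, ∀ v ∈ C, G.owner u = G.owner v) :
    infSet (fun n => T.machine.pos (s n)) = infSet (fun n => T.path (T.next^[n] T.init)) ∨
      ∃ i, T.path i ∈ C ∧ ∃ x, (T.graph i).IsPath x ∧
        infSet (fun n => T.machine.pos (s n)) = infSet (fun n => (T.graph i).pos (x n)) := by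
  obtain hlead | ⟨i, hi, m, q, hm⟩ := lead_or_exists_punish hs
  · refine .inl (congrArg infSet (funext fun n => ?_))
    rw [hlead]
    rfl
  · obtain ⟨x, hx, hsx⟩ := exists_isPath_of_punish hs (fun v hv => hC v hv _ hi) hm
    refine .inr ⟨i, hi, x, hx, ?_⟩
    rw [← infSet_add _ m]
    refine congrArg infSet (funext fun n => ?_)
    rw [hsx]
    rfl

end Play

end PunishmentPlan

theorem exists_isFiniteMemory_infSet_eq [Finite V] {p : ℕ → V} (hp : G.IsRun p)
    {W : A → Set (Set V)}
    (hW : ∀ n, p n ∈ winningRegion G.E {v | G.owner v = G.owner (p n)}ᶜ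
      (W (G.owner (p n))) Set.univ ∅) :
    ∃ σ : G.Profile, G.IsFiniteMemory σ ∧ infSet (G.inducedRun σ) = infSet p ∧
      ∀ a τ, (∀ b ≠ a, τ b = σ b) →
        infSet (G.inducedRun τ) = infSet p ∨ infSet (G.inducedRun τ) ∈ W a := by
  obtain ⟨M, next, idx, hidx, hnext, hpnext, hinf⟩ := exists_finite_reindexing p
  choose S hS root hroot using hW
  let T : PunishmentPlan G :=
    { Index := Fin M
      init := idx 0
      next := next
      path := fun i => p i
      path_init := by rw [hidx, hp.1]
      edge_path := fun i => hpnext i ▸ hp.2 i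
      graph := fun i => S i
      root := fun i => root i
      pos_root := fun i => hroot i }
  have hiter : ∀ n, T.next^[n] T.init = idx n := by
    intro n
    induction n with
    | zero => rfl
    | succ n ih => rw [Function.iterate_succ_apply', ih, hnext]
  have hpath : infSet (fun n => T.path (T.next^[n] T.init)) = infSet p := by
    simp only [hiter]
    exact hinf
  refine ⟨T.machine.profile, T.machine.isFiniteMemory_profile, ?_, fun a τ hτ => ?_⟩
  · obtain h | ⟨_, hi, -⟩ := T.infSet_of_isPlay (C := ∅)
      (T.machine.isPlay_stateAfter fun _ _ => rfl) fun _ hu => hu.elim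
    · rw [← Machine.infSet_pos_stateAfter, h, hpath]
    · exact hi.elim
  · obtain h | ⟨i, hi, x, hx, h⟩ := T.infSet_of_isPlay (C := {v | G.owner v = a})
      (T.machine.isPlay_stateAfter fun v hv => hτ _ hv) fun _ hu _ hv => hu.trans hv.symm
    · exact .inl (by rw [← T.machine.infSet_pos_stateAfter, h, hpath])
    · refine .inr ?_
      rw [← T.machine.infSet_pos_stateAfter, h, ← show G.owner (T.path i) = a from hi]
      exact hS i x hx

end Punishment

/-! ### Outcomes -/

section Outcome

theorem exists_nat_rank {α : Type*} [Finite α] {R : α → α → Prop}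
    (hR : ∀ x, ¬ Relation.TransGen R x x) : ∃ ρ : α → ℕ, ∀ x y, R x y → ρ x < ρ y :=
  ⟨fun x => {y | Relation.TransGen R y x}.ncard, fun x _ hxy =>
    Set.ncard_lt_ncard ⟨fun _ hz => .tail hz hxy, fun hsub => hR x (hsub (.single hxy))⟩⟩

variable {V : Type u} {A O : Type*} {G : MullerGame V A O}

instance [Finite V] : Finite G.RealizableOutcome := by
  choose p hp using fun o : G.RealizableOutcome => o.2
  refine Finite.of_injective (fun o => infSet (p o)) fun x y h => Subtype.ext ?_
  rw [← (hp x).2, ← (hp y).2]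
  exact congrArg G.outcome h

instance : Nonempty G.RealizableOutcome :=
  ⟨G.inducedOutcome fun _ =>
    ⟨fun h => (G.exists_succ h.1.last).choose, fun h => (G.exists_succ h.1.last).choose_spec⟩⟩

/-- The payoff associated with a set of vertices visited infinitely often: it is `ρ o + 1` if the
outcome `o` is in `K`, and zero otherwise. -/
noncomputable def payoff (K : Set G.RealizableOutcome) (ρ : G.RealizableOutcome → ℕ) :
    Set V → ℕ :=
  fun B => Function.extend (fun o : K => o.1.1) (fun o => ρ o + 1) 0 (G.outcome B)

theorem payoff_eq {K : Set G.RealizableOutcome} (ρ : G.RealizableOutcome → ℕ)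
    {o : G.RealizableOutcome} (ho : o ∈ K) {B : Set V} (h : G.outcome B = o.1) :
    payoff K ρ B = ρ o + 1 := by
  rw [payoff, h]
  exact (Subtype.val_injective.comp Subtype.val_injective).extend_apply _ _ (⟨o, ho⟩ : K)

theorem exists_mem_of_payoff_pos {K : Set G.RealizableOutcome} {ρ : G.RealizableOutcome → ℕ}
    {B : Set V} (h : 0 < payoff K ρ B) : ∃ o ∈ K, o.1 = G.outcome B := by
  by_contra! hB
  refine h.ne' (Function.extend_apply' _ _ _ ?_)
  rintro ⟨o, ho⟩
  exact hB _ o.2 ho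

theorem AcyclicPreferences.exists_isNash_mem [Finite V] (hG : G.AcyclicPreferences)
    {K : Set G.RealizableOutcome} (hK : K.Nonempty)
    (hupper : ∀ a, ∀ x ∈ K, ∀ y, G.Prefers a x y → y ∈ K) :
    ∃ σ : G.Profile, G.IsNash σ ∧ G.IsFiniteMemory σ ∧ G.inducedOutcome σ ∈ K := by
  classical
  choose ρ hρ using fun a => exists_nat_rank (hG a)
  obtain ⟨o, ho⟩ := hK
  obtain ⟨p₀, hp₀, hp₀o⟩ := o.2
  have hE : IsArena G.E Set.univ := fun v _ => (G.exists_succ v).imp fun w hw => ⟨trivial, hw⟩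
  obtain ⟨p, hp0, hpE, hvalue, hp⟩ :=
    exists_path_value_le_of_path hE G.owner (fun a => payoff K (ρ a)) hp₀.2
  obtain ⟨σ, hσ, hσp, hdev⟩ := exists_isFiniteMemory_infSet_eq ⟨hp0.trans hp₀.1, hpE⟩
    (W := fun a => {B | payoff K (ρ a) B ≤ payoff K (ρ a) (infSet p)}) fun n =>
      winningRegion_mono (fun B hB => le_trans hB (hvalue _ n))
        (mem_winningRegion_compl_value hE _ _ (p n))
  have hσK : G.inducedOutcome σ ∈ K := by
    obtain ⟨x, hx, hxp⟩ : ∃ x ∈ K, x.1 = G.outcome (infSet p) := by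
      obtain hp | ⟨a, ha⟩ := hp
      exacts [⟨o, ho, by rw [hp, hp₀o]⟩, exists_mem_of_payoff_pos ha]
    rwa [show G.inducedOutcome σ = x from Subtype.ext (by rw [hxp, ← hσp]; rfl)]
  refine ⟨σ, fun a s hpref => ?_, hσ, hσK⟩
  have hle : payoff K (ρ a) (infSet (G.inducedRun (Function.update σ a s))) ≤
      payoff K (ρ a) (infSet (G.inducedRun σ)) := by
    rw [hσp]
    exact (hdev a _ fun b hb => Function.update_of_ne hb _ _).elim (fun h => h ▸ le_rfl) id
  rw [payoff_eq _ hσK rfl, payoff_eq _ (hupper a _ hσK _ hpref) rfl, Nat.succ_le_succ_iff] at hle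
  exact (hρ a _ _ hpref).not_ge hle

namespace LinearPreferences

variable (hG : G.LinearPreferences) {a : A} {x y : G.RealizableOutcome}

include hG

theorem trans {z : G.RealizableOutcome} (hxy : G.Prefers a x y) (hyz : G.Prefers a y z) :
    G.Prefers a x z :=
  (hG a).toIsStrictOrder.toIsTrans.trans _ _ _ hxy hyz

theorem asymm (h : G.Prefers a x y) : ¬ G.Prefers a y x := fun h' =>
  (hG a).toIsStrictOrder.toIrrefl.irrefl _ (hG.trans h h')

theorem prefers_or_prefers (a : A) (h : x ≠ y) : G.Prefers a x y ∨ G.Prefers a y x := by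
  by_contra! hcon
  exact h ((hG a).toTrichotomous.trichotomous x y hcon.1 hcon.2)

theorem acyclicPreferences : G.AcyclicPreferences := by
  intro a x h
  have := (hG a).toIsStrictOrder.toIsTrans
  rw [Relation.transGen_eq_self] at h
  exact hG.asymm h h

theorem exists_prefers_of_isParetoOptimal (hy : G.IsParetoOptimal y) (h : x ≠ y) :
    ∃ b, G.Prefers b x y := by
  by_contra! hcon
  exact hy ⟨x, h, ⟨G.owner G.start, (hG.prefers_or_prefers _ h).resolve_left (hcon _)⟩, hcon⟩

theorem exists_forall_prefers_of_not_isParetoOptimal (hx : ¬ G.IsParetoOptimal x) :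
    ∃ y, ∀ b, G.Prefers b x y := by
  obtain ⟨y, hne, -, hy⟩ := not_not.1 hx
  exact ⟨y, fun b => (hG.prefers_or_prefers b hne).resolve_left (hy b)⟩

theorem exists_isParetoOptimal [Finite V] (x : G.RealizableOutcome) :
    ∃ y, G.IsParetoOptimal y ∧ (y = x ∨ ∀ b, G.Prefers b x y) := by
  obtain ⟨ρ, hρ⟩ := exists_nat_rank (hG.acyclicPreferences (G.owner G.start))
  obtain ⟨y, hxy, hmax⟩ := Set.exists_max_image {y | y = x ∨ ∀ b, G.Prefers b x y} ρ
    (Set.toFinite _) ⟨x, .inl rfl⟩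
  refine ⟨y, by_contra fun hy => ?_, hxy⟩
  obtain ⟨z, hyz⟩ := hG.exists_forall_prefers_of_not_isParetoOptimal hy
  have hxz : ∀ b, G.Prefers b x z := by
    obtain rfl | hxy := hxy
    exacts [hyz, fun b => hG.trans (hxy b) (hyz b)]
  exact (hρ y z (hyz _)).not_ge (hmax z (.inr hxz))

theorem prefers_of_not_isParetoOptimal_of_isParetoOptimal [Finite V] (hpat : G.AvoidsPattern)
    (hx : ¬ G.IsParetoOptimal x) (hy : G.IsParetoOptimal y) (a : A) : G.Prefers a x y := by
  obtain ⟨q, hq, rfl | hxq⟩ := hG.exists_isParetoOptimal x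
  · exact absurd hq hx
  by_cases hqy : q = y
  · exact hqy ▸ hxq a
  · have hxy : x ≠ y := fun h => hx (h ▸ hy)
    refine (hG.prefers_or_prefers a hxy).resolve_right fun hyx => ?_
    obtain ⟨b, hqy⟩ := hG.exists_prefers_of_isParetoOptimal hy hqy
    exact hpat b a y q x ⟨⟨hxq b, hqy⟩, hyx, hxq a⟩

end LinearPreferences

end Outcome

end MullerGame

theorem theorem41 {V A O : Type*} [Finite V] (G : MullerGame V A O) :
    (G.AcyclicPreferences → ∃ σ : G.Profile, G.IsNash σ ∧ G.IsFiniteMemory σ) ∧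
    (G.LinearPreferences → G.AvoidsPattern →
      ∃ σ : G.Profile, G.IsNash σ ∧ G.IsFiniteMemory σ ∧
        G.IsParetoOptimal (G.inducedOutcome σ)) := by
  refine ⟨fun hG => ?_, fun hG hpat => ?_⟩
  · obtain ⟨σ, hnash, hmem, -⟩ := hG.exists_isNash_mem Set.univ_nonempty fun _ _ _ _ _ => trivial
    exact ⟨σ, hnash, hmem⟩
  · obtain ⟨o, ho, -⟩ := hG.exists_isParetoOptimal (Classical.arbitrary G.RealizableOutcome)
    refine hG.acyclicPreferences.exists_isNash_mem (K := {o | G.IsParetoOptimal o}) ⟨o, ho⟩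
      fun a x hx y hxy => by_contra fun hy => ?_
    exact hG.asymm hxy (hG.prefers_of_not_isParetoOptimal_of_isParetoOptimal hpat hy hx a)
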